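/- Let $\mathbb F$ be $\mathbb R$ or $\mathbb C$, let $H$ be a (not necessarily separable) Hilbert space over $\mathbb F$ with inner product $\langle\cdot|\cdot\rangle$, let $\mathscr B(H)$ be the space of bounded linear operators on $H$ with the operator norm, and let $\mathscr K(H)\subseteq\mathscr B(H)$ be the subspace of compact operators. Let $0\neq A\in\mathscr B(H)$ satisfy $\operatorname{dist}(A,\mathscr K(H))=\inf\{\|A-K\|:K\in\mathscr K(H)\}<\|A\|$. Then for every $B\in\mathscr B(H)$ the one-sided limit below exists, both maxima below exist (in particular, they are taken over nonempty sets and are attained), and $$\lim_{t\to0^+}\frac{\|A+tB\|-\|A\|}{t}=\max\{\operatorname{Re}\langle v|Bu\rangle : u,v\in H,\ \|u\|=\|v\|=1,\ Au=\|A\|v\}$$ $$=\frac1{\|A\|}\max\{\operatorname{Re}\langle Au|Bu\rangle : u\in H,\ \|u\|=1,\ A^*Au=\|A\|^2u\}.$$ -/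

import Mathlib

open Filter
open scoped Topology

section NormDerivative

variable {𝕜 : Type*} [RCLike 𝕜] {H : Type*} [NormedAddCommGroup H] [InnerProductSpace 𝕜 H]

section Adjoint

variable [CompleteSpace H]

/-! Every unit maximizer of `A` bounds the difference quotient from below, by Cauchy–Schwarz. For
the upper bound, near-maximizers `u n` of `A + t n • B` form a maximizing sequence for `A`, so by
the estimate below `‖A‖² u - A*A u → 0` along it. Choose `K` compact with `‖A - K‖ < ‖A‖` and write
`A*A = A*(A - K) + A*K`: the operator `‖A‖² - A*(A - K)` is bounded below and `A*K` is compact, so a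
subsequence converges in norm. Its limit is a unit maximizer at which both bounds meet; the lower
bound makes its value the maximum, hence the same for all subsequences. -/

theorem norm_sq_smul_sub_adjoint_apply_sq_le (A : H →L[𝕜] H) (u : H) :
    ‖((‖A‖ ^ 2 : ℝ) : 𝕜) • u - (ContinuousLinearMap.adjoint A) (A u)‖ ^ 2
      ≤ ‖A‖ ^ 4 * ‖u‖ ^ 2 - ‖A‖ ^ 2 * ‖A u‖ ^ 2 := by
  have h1 := norm_sub_sq (𝕜 := 𝕜) (((‖A‖ ^ 2 : ℝ) : 𝕜) • u) ((ContinuousLinearMap.adjoint A) (A u))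
  have h2 : RCLike.re (inner 𝕜 (((‖A‖ ^ 2 : ℝ) : 𝕜) • u) ((ContinuousLinearMap.adjoint A) (A u)))
      = ‖A‖ ^ 2 * ‖A u‖ ^ 2 := by
    rw [inner_smul_left, ContinuousLinearMap.adjoint_inner_right, RCLike.conj_ofReal,
      RCLike.re_ofReal_mul, inner_self_eq_norm_sq]
  have h3 : ‖(ContinuousLinearMap.adjoint A) (A u)‖ ≤ ‖A‖ * ‖A u‖ := by
    simpa using (ContinuousLinearMap.adjoint A).le_opNorm (A u)
  have h4 : ‖(ContinuousLinearMap.adjoint A) (A u)‖ ^ 2 ≤ ‖A‖ ^ 2 * ‖A u‖ ^ 2 := by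
    rw [← mul_pow]; gcongr
  have h5 : ‖((‖A‖ ^ 2 : ℝ) : 𝕜) • u‖ ^ 2 = ‖A‖ ^ 4 * ‖u‖ ^ 2 := by
    rw [norm_smul, RCLike.norm_ofReal, abs_of_nonneg (by positivity)]; ring
  rw [h2, h5] at h1
  linarith

/-- A unit vector is maximizing for `A` iff it is an eigenvector of `A* A` for `‖A‖ ^ 2`. -/
theorem adjoint_apply_eq_norm_sq_smul_iff (A : H →L[𝕜] H) {u : H} (hu : ‖u‖ = 1) :
    (ContinuousLinearMap.adjoint A) (A u) = ((‖A‖ ^ 2 : ℝ) : 𝕜) • u ↔ ‖A u‖ = ‖A‖ := by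
  constructor
  · intro h
    have h1 : ‖A u‖ ^ 2 = ‖A‖ ^ 2 := by
      rw [← inner_self_eq_norm_sq (𝕜 := 𝕜), ← ContinuousLinearMap.adjoint_inner_right, h,
        inner_smul_right, RCLike.re_ofReal_mul, inner_self_eq_norm_sq, hu]
      ring
    exact (sq_eq_sq₀ (norm_nonneg _) (norm_nonneg _)).1 h1
  · intro h
    have h1 := norm_sq_smul_sub_adjoint_apply_sq_le A u
    rw [hu, h] at h1
    have h2 : ‖((‖A‖ ^ 2 : ℝ) : 𝕜) • u - (ContinuousLinearMap.adjoint A) (A u)‖ ^ 2 = 0 :=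
      le_antisymm (by linarith) (by positivity)
    exact (sub_eq_zero.1 (norm_eq_zero.1 (pow_eq_zero_iff two_ne_zero |>.1 h2))).symm

/-- If `A` is closer than `‖A‖` to a compact operator, then maximizing sequences for `A` have
convergent subsequences. -/
theorem exists_subseq_tendsto_of_tendsto_norm_apply {A K : H →L[𝕜] H} (hK : IsCompactOperator K)
    (hAK : ‖A - K‖ < ‖A‖) {u : ℕ → H} (hu : ∀ n, ‖u n‖ ≤ 1)
    (hA : Tendsto (fun n => ‖A (u n)‖) atTop (𝓝 ‖A‖)) :
    ∃ (x : H) (φ : ℕ → ℕ), StrictMono φ ∧ Tendsto (u ∘ φ) atTop (𝓝 x) := by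
  have ha : 0 < ‖A‖ := (norm_nonneg _).trans_lt hAK
  set S := ContinuousLinearMap.adjoint A with hS
  set T : H →L[𝕜] H := ((‖A‖ ^ 2 : ℝ) : 𝕜) • ContinuousLinearMap.id 𝕜 H - S ∘L (A - K) with hT
  -- `T = ‖A‖ ^ 2 - A* (A - K)` is bounded below
  have hTb : ∀ x, (‖A‖ ^ 2 - ‖A‖ * ‖A - K‖) * ‖x‖ ≤ ‖T x‖ := fun x => by
    have h1 : ‖S ((A - K) x)‖ ≤ ‖A‖ * ‖A - K‖ * ‖x‖ := by
      calc ‖S ((A - K) x)‖ ≤ ‖S‖ * ‖(A - K) x‖ := S.le_opNorm _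
        _ ≤ ‖A‖ * (‖A - K‖ * ‖x‖) := by
          rw [hS, LinearIsometryEquiv.norm_map]
          gcongr
          exact (A - K).le_opNorm x
        _ = _ := by ring
    have h2 : T x = ((‖A‖ ^ 2 : ℝ) : 𝕜) • x - S ((A - K) x) := rfl
    have h3 : ‖((‖A‖ ^ 2 : ℝ) : 𝕜) • x‖ = ‖A‖ ^ 2 * ‖x‖ := by
      rw [norm_smul, RCLike.norm_ofReal, abs_of_nonneg (by positivity)]
    have h4 := norm_sub_norm_le (((‖A‖ ^ 2 : ℝ) : 𝕜) • x) (S ((A - K) x))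
    rw [h2]
    linarith
  have hc : 0 < ‖A‖ ^ 2 - ‖A‖ * ‖A - K‖ := by nlinarith
  have hanti : AntilipschitzWith (Real.toNNReal (‖A‖ ^ 2 - ‖A‖ * ‖A - K‖)⁻¹) T := by
    refine ContinuousLinearMap.antilipschitz_of_bound T fun x => ?_
    rw [Real.coe_toNNReal _ (inv_nonneg.2 hc.le), inv_mul_eq_div, le_div_iff₀' hc]
    exact hTb x
  have hres : Tendsto (fun n => ((‖A‖ ^ 2 : ℝ) : 𝕜) • u n - S (A (u n))) atTop (𝓝 0) := by
    have hlim : Tendsto (fun n => ‖A‖ ^ 4 - ‖A‖ ^ 2 * ‖A (u n)‖ ^ 2) atTop (𝓝 0) := by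
      have := ((hA.pow 2).const_mul (‖A‖ ^ 2)).const_sub (‖A‖ ^ 4)
      convert this using 2
      ring
    have hsq : Tendsto (fun n => ‖((‖A‖ ^ 2 : ℝ) : 𝕜) • u n - S (A (u n))‖ ^ 2) atTop (𝓝 0) := by
      refine squeeze_zero (fun n => by positivity) (fun n => ?_) hlim
      refine (norm_sq_smul_sub_adjoint_apply_sq_le A (u n)).trans ?_
      have : ‖u n‖ ^ 2 ≤ 1 := pow_le_one₀ (norm_nonneg _) (hu n)
      have : ‖A‖ ^ 4 * ‖u n‖ ^ 2 ≤ ‖A‖ ^ 4 * 1 := by gcongr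
      linarith
    rw [tendsto_zero_iff_norm_tendsto_zero]
    have := hsq.sqrt
    simpa using this
  have hSK : IsCompactOperator (S ∘L K) := hK.clm_comp S
  obtain ⟨C, hC, hCK⟩ := hSK.image_closedBall_subset_compact 1
  obtain ⟨y, -, φ, hφ, hy⟩ := hC.tendsto_subseq (x := fun n => S (K (u n))) fun n =>
    hCK ⟨u n, by simpa using hu n, rfl⟩
  -- `T u = (‖A‖² u - A*A u) + A*K u`: the first part tends to `0`, the second converges by
  -- compactness.
  have hTy : Tendsto (fun n => T (u (φ n))) atTop (𝓝 y) := by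
    have := (hres.comp hφ.tendsto_atTop).add hy
    rw [zero_add] at this
    refine this.congr fun n => ?_
    simp [hT]
    abel
  have hcau : CauchySeq (u ∘ φ) := by
    rw [CauchySeq, ← (hanti.isUniformInducing T.uniformContinuous).cauchy_map_iff]
    exact hTy.cauchySeq
  obtain ⟨x, hx⟩ := cauchySeq_tendsto_of_complete hcau
  exact ⟨x, φ, hφ, hx⟩

end Adjoint

/-- Cauchy–Schwarz for `A u` against `(A + t B) u`, where `‖A u‖ = ‖A‖`. -/
theorem re_inner_apply_div_le_norm_add_smul_sub_div {A B : H →L[𝕜] H} {u : H} (hA : A ≠ 0)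
    (hu : ‖u‖ = 1) (hAu : ‖A u‖ = ‖A‖) {t : ℝ} (ht : 0 < t) :
    RCLike.re (inner 𝕜 (A u) (B u)) / ‖A‖ ≤ (‖A + (t : 𝕜) • B‖ - ‖A‖) / t := by
  have ha : 0 < ‖A‖ := norm_pos_iff.2 hA
  have h1 : RCLike.re (inner 𝕜 (A u) ((A + (t : 𝕜) • B) u)) ≤ ‖A‖ * ‖A + (t : 𝕜) • B‖ := by
    refine (re_inner_le_norm _ _).trans ?_
    rw [hAu]
    gcongr
    simpa [hu] using (A + (t : 𝕜) • B).le_opNorm u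
  have h2 : RCLike.re (inner 𝕜 (A u) ((A + (t : 𝕜) • B) u))
      = ‖A‖ ^ 2 + t * RCLike.re (inner 𝕜 (A u) (B u)) := by
    rw [add_apply, smul_apply, inner_add_right, inner_smul_right, map_add, RCLike.re_ofReal_mul,
      inner_self_eq_norm_sq, hAu]
  rw [div_le_div_iff₀ ha ht]
  nlinarith

/-- With `w = (A + t B) u`, expand `‖w‖² = Re⟨w|Au⟩ + t Re⟨w|Bu⟩` and bound the first term by `‖w‖
‖A‖`. Here `u` need not maximize anything. -/
theorem norm_add_smul_apply_sub_div_le {A B : H →L[𝕜] H} {u : H} (hu : ‖u‖ ≤ 1) {t : ℝ}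
    (ht : 0 < t) (hw : 0 < ‖(A + (t : 𝕜) • B) u‖) :
    (‖(A + (t : 𝕜) • B) u‖ - ‖A‖) / t
      ≤ RCLike.re (inner 𝕜 ((A + (t : 𝕜) • B) u) (B u)) / ‖(A + (t : 𝕜) • B) u‖ := by
  set w := (A + (t : 𝕜) • B) u with hwdef
  have h1 : ‖w‖ ^ 2 = RCLike.re (inner 𝕜 w (A u)) + t * RCLike.re (inner 𝕜 w (B u)) := by
    rw [← inner_self_eq_norm_sq (𝕜 := 𝕜), ← RCLike.re_ofReal_mul, ← inner_smul_right, ← map_add,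
      ← inner_add_right]
    rfl
  have h2 : RCLike.re (inner 𝕜 w (A u)) ≤ ‖w‖ * ‖A‖ := by
    refine (re_inner_le_norm _ _).trans ?_
    gcongr
    exact A.unit_le_opNorm u hu
  rw [div_le_div_iff₀ ht hw]
  nlinarith

variable [CompleteSpace H]

theorem exists_subseq_tendsto_norm_add_smul_sub_div {A K : H →L[𝕜] H} (B : H →L[𝕜] H)
    (hK : IsCompactOperator K) (hAK : ‖A - K‖ < ‖A‖) {t : ℕ → ℝ}
    (ht : Tendsto t atTop (𝓝[>] 0)) (hpos : ∀ n, 0 < t n) :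
    ∃ (x : H) (φ : ℕ → ℕ), ‖x‖ = 1 ∧ ‖A x‖ = ‖A‖ ∧
      Tendsto (fun n => (‖A + (t (φ n) : 𝕜) • B‖ - ‖A‖) / t (φ n)) atTop
        (𝓝 (RCLike.re (inner 𝕜 (A x) (B x)) / ‖A‖)) := by
  have ha : 0 < ‖A‖ := (norm_nonneg _).trans_lt hAK
  have ht0 : Tendsto t atTop (𝓝 0) := ht.mono_right nhdsWithin_le_nhds
  -- `A + t n • B` need not attain its norm; the defect `t n ^ 2` still vanishes after division by
  -- `t n`.
  have hex : ∀ n, ∃ u : H, ‖u‖ ≤ 1 ∧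
      ‖A + (t n : 𝕜) • B‖ - t n ^ 2 < ‖(A + (t n : 𝕜) • B) u‖ := fun n => by
    obtain ⟨x, hx, hx'⟩ := ContinuousLinearMap.exists_lt_apply_of_lt_opNorm (A + (t n : 𝕜) • B)
      (sub_lt_self _ (pow_pos (hpos n) 2))
    exact ⟨x, hx.le, hx'⟩
  choose u hu hmax using hex
  have hnt : ∀ n, ‖(t n : 𝕜)‖ = t n := fun n => by
    rw [RCLike.norm_ofReal, abs_of_pos (hpos n)]
  have hAu : Tendsto (fun n => ‖A (u n)‖) atTop (𝓝 ‖A‖) := by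
    have hlow : Tendsto (fun n => ‖A‖ - 2 * (t n * ‖B‖) - t n ^ 2) atTop (𝓝 ‖A‖) := by
      have := (((ht0.mul_const ‖B‖).const_mul 2).const_sub ‖A‖).sub (ht0.pow 2)
      simpa using this
    refine tendsto_of_tendsto_of_tendsto_of_le_of_le hlow tendsto_const_nhds (fun n => ?_)
      fun n => A.unit_le_opNorm _ (hu n)
    have h1 : ‖A‖ ≤ ‖A + (t n : 𝕜) • B‖ + t n * ‖B‖ := by
      have := norm_sub_le (A + (t n : 𝕜) • B) ((t n : 𝕜) • B)
      rwa [add_sub_cancel_right, norm_smul, hnt] at this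
    have h2 : ‖(A + (t n : 𝕜) • B) (u n)‖ ≤ ‖A (u n)‖ + t n * ‖B‖ := by
      rw [add_apply, smul_apply]
      refine (norm_add_le _ _).trans ?_
      rw [norm_smul, hnt]
      have := B.unit_le_opNorm _ (hu n)
      have := (hpos n).le
      gcongr
    have h3 := hmax n
    dsimp only
    linarith
  obtain ⟨x, φ, hφ, hx⟩ := exists_subseq_tendsto_of_tendsto_norm_apply hK hAK hu hAu
  have htφ : Tendsto (fun n => t (φ n)) atTop (𝓝 0) := ht0.comp hφ.tendsto_atTop
  have hAx : ‖A x‖ = ‖A‖ :=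
    tendsto_nhds_unique ((A.continuous.tendsto x).comp hx).norm (hAu.comp hφ.tendsto_atTop)
  -- The `u n` lie only in the unit ball; `‖A‖ = ‖A x‖ ≤ ‖A‖ ‖x‖` forces the limit onto the sphere.
  have hx1 : ‖x‖ = 1 := by
    refine le_antisymm (le_of_tendsto' hx.norm fun n => hu _) ?_
    have := A.le_opNorm x
    rw [hAx] at this
    exact le_of_mul_le_mul_left (by simpa using this) ha
  have hA0 : A ≠ 0 := norm_pos_iff.1 ha
  have htk : Tendsto (fun n => (t (φ n) : 𝕜)) atTop (𝓝 0) := by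
    have := ((RCLike.continuous_ofReal (K := 𝕜)).tendsto 0).comp htφ
    rwa [RCLike.ofReal_zero] at this
  have hBx : Tendsto (fun n => B (u (φ n))) atTop (𝓝 (B x)) := (B.continuous.tendsto x).comp hx
  have hw : Tendsto (fun n => (A + (t (φ n) : 𝕜) • B) (u (φ n))) atTop (𝓝 (A x)) := by
    have := ((A.continuous.tendsto x).comp hx).add (htk.smul hBx)
    simpa using this
  have hup : Tendsto (fun n => RCLike.re (inner 𝕜 ((A + (t (φ n) : 𝕜) • B) (u (φ n)))
      (B (u (φ n)))) / ‖(A + (t (φ n) : 𝕜) • B) (u (φ n))‖ + t (φ n)) atTop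
        (𝓝 (RCLike.re (inner 𝕜 (A x) (B x)) / ‖A‖)) := by
    have h1 := (RCLike.continuous_re.tendsto _).comp (hw.inner (𝕜 := 𝕜) hBx)
    have h2 := (h1.div hw.norm (by rw [hAx]; exact ha.ne')).add htφ
    rw [hAx, add_zero] at h2
    exact h2
  refine ⟨x, φ, hx1, hAx, tendsto_of_tendsto_of_tendsto_of_le_of_le' tendsto_const_nhds hup
    (Eventually.of_forall fun n =>
      re_inner_apply_div_le_norm_add_smul_sub_div hA0 hx1 hAx (hpos _)) ?_⟩
  have hwpos := hw.norm.eventually_const_lt (u := 0) (by rw [hAx]; exact ha)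
  filter_upwards [hwpos] with n hn
  have h1 := norm_add_smul_apply_sub_div_le (hu (φ n)) (hpos (φ n)) hn
  have h2 := hmax (φ n)
  have h3 : (‖A + (t (φ n) : 𝕜) • B‖ - ‖A‖) / t (φ n)
      ≤ (‖(A + (t (φ n) : 𝕜) • B) (u (φ n))‖ - ‖A‖) / t (φ n) + t (φ n) := by
    rw [div_add' _ _ _ (hpos _).ne']
    have := (hpos (φ n)).le
    gcongr
    nlinarith
  linarith

/-- The one-sided derivative of the operator norm at `A` in the direction `B`. -/
theorem exists_tendsto_norm_add_smul_sub_div {A K : H →L[𝕜] H} (B : H →L[𝕜] H)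
    (hK : IsCompactOperator K) (hAK : ‖A - K‖ < ‖A‖) :
    ∃ x : H, ‖x‖ = 1 ∧ ‖A x‖ = ‖A‖ ∧
      (∀ u : H, ‖u‖ = 1 → ‖A u‖ = ‖A‖ →
        RCLike.re (inner 𝕜 (A u) (B u)) ≤ RCLike.re (inner 𝕜 (A x) (B x))) ∧
      Tendsto (fun t : ℝ => (‖A + (t : 𝕜) • B‖ - ‖A‖) / t) (𝓝[>] 0)
        (𝓝 (RCLike.re (inner 𝕜 (A x) (B x)) / ‖A‖)) := by
  have ha : 0 < ‖A‖ := (norm_nonneg _).trans_lt hAK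
  have key : ∀ t : ℕ → ℝ, Tendsto t atTop (𝓝[>] 0) → ∃ (x : H) (φ : ℕ → ℕ),
      ‖x‖ = 1 ∧ ‖A x‖ = ‖A‖ ∧
      (∀ u : H, ‖u‖ = 1 → ‖A u‖ = ‖A‖ →
        RCLike.re (inner 𝕜 (A u) (B u)) ≤ RCLike.re (inner 𝕜 (A x) (B x))) ∧
      Tendsto (fun n => (‖A + (t (φ n) : 𝕜) • B‖ - ‖A‖) / t (φ n)) atTop
        (𝓝 (RCLike.re (inner 𝕜 (A x) (B x)) / ‖A‖)) := by
    intro t ht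
    -- Convergence in `𝓝[>] 0` gives positivity only eventually, hence the shift by `N`.
    obtain ⟨N, hN⟩ := eventually_atTop.1 (ht.eventually self_mem_nhdsWithin)
    have hpos : ∀ n, 0 < t (n + N) := fun n => hN _ (Nat.le_add_left _ _)
    obtain ⟨x, φ, hx1, hAx, hlim⟩ := exists_subseq_tendsto_norm_add_smul_sub_div B hK hAK
      ((tendsto_add_atTop_iff_nat N).2 ht) hpos
    refine ⟨x, fun n => φ n + N, hx1, hAx, fun u hu hAu => ?_, hlim⟩
    have := ge_of_tendsto' hlim fun n => re_inner_apply_div_le_norm_add_smul_sub_div (B := B)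
      (norm_pos_iff.1 ha) hu hAu (hpos (φ n))
    exact (div_le_div_iff_of_pos_right ha).1 this
  obtain ⟨s, hs⟩ := exists_seq_tendsto (𝓝[>] (0 : ℝ))
  obtain ⟨x, -, hx1, hAx, hmax, -⟩ := key s hs
  refine ⟨x, hx1, hAx, hmax, tendsto_of_subseq_tendsto fun t ht => ?_⟩
  obtain ⟨y, φ, hy1, hAy, hmax', hlim⟩ := key t ht
  -- `x` and `y` both maximize the same functional, so the subsequential limits coincide.
  rw [le_antisymm (hmax' x hx1 hAx) (hmax y hy1 hAy)]
  exact ⟨φ, hlim⟩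

end NormDerivative

theorem mainTheorem4 {𝕜 : Type*} [RCLike 𝕜]
    {H : Type*} [NormedAddCommGroup H] [InnerProductSpace 𝕜 H] [CompleteSpace H]
    (A : H →L[𝕜] H) (hA : A ≠ 0)
    (hdist : Metric.infDist A (compactOperator (RingHom.id 𝕜) H H : Set (H →L[𝕜] H)) < ‖A‖)
    (B : H →L[𝕜] H) :
    ∃ D M : ℝ,
      Tendsto (fun t : ℝ => (‖A + (t : 𝕜) • B‖ - ‖A‖) / t) (𝓝[>] 0) (𝓝 D) ∧
      IsGreatest {r : ℝ | ∃ u v : H, ‖u‖ = 1 ∧ ‖v‖ = 1 ∧ A u = (‖A‖ : 𝕜) • v ∧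
        r = RCLike.re (inner 𝕜 v (B u))} D ∧
      IsGreatest {r : ℝ | ∃ u : H, ‖u‖ = 1 ∧
        (ContinuousLinearMap.adjoint A) (A u) = ((‖A‖ ^ 2 : ℝ) : 𝕜) • u ∧
        r = RCLike.re (inner 𝕜 (A u) (B u))} M ∧
      D = (1 / ‖A‖) * M := by

  have ha : 0 < ‖A‖ := norm_pos_iff.2 hA
  obtain ⟨K, hK, hAK⟩ := (Metric.infDist_lt_iff ⟨0, Submodule.zero_mem _⟩).1 hdist
  rw [dist_eq_norm] at hAK
  obtain ⟨x, hx1, hAx, hmax, hlim⟩ := exists_tendsto_norm_add_smul_sub_div B hK hAK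
  have hak : (‖A‖ : 𝕜) ≠ 0 := RCLike.ofReal_ne_zero.2 ha.ne'
  refine ⟨_, RCLike.re (inner 𝕜 (A x) (B x)), hlim, ⟨?_, ?_⟩, ⟨?_, ?_⟩, by ring⟩
  -- The equation `A u = ‖A‖ v` forces `v = A u / ‖A‖`.
  · refine ⟨x, ((‖A‖⁻¹ : ℝ) : 𝕜) • A x, hx1, ?_, ?_, ?_⟩
    · rw [norm_smul, RCLike.norm_ofReal, abs_of_pos (inv_pos.2 ha), hAx, inv_mul_cancel₀ ha.ne']
    · rw [smul_smul, RCLike.ofReal_inv, mul_inv_cancel₀ hak, one_smul]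
    · rw [inner_smul_left, RCLike.conj_ofReal, RCLike.re_ofReal_mul]
      ring
  · rintro _ ⟨u, v, hu, hv, huv, rfl⟩
    have hAu : ‖A u‖ = ‖A‖ := by
      rw [huv, norm_smul, RCLike.norm_ofReal, abs_of_pos ha, hv, mul_one]
    have := hmax u hu hAu
    rw [huv, inner_smul_left, RCLike.conj_ofReal, RCLike.re_ofReal_mul] at this
    rwa [le_div_iff₀' ha]
  · exact ⟨x, hx1, (adjoint_apply_eq_norm_sq_smul_iff A hx1).2 hAx, rfl⟩
  · rintro _ ⟨u, hu, h, rfl⟩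
    exact hmax u hu ((adjoint_apply_eq_norm_sq_smul_iff A hu).1 h)
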